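/- Theorem 1 (Hypergeometric (ir)rationality criteria for $\gamma$). For a positive integer $N$ let $d_N=\mathrm{LCM}(1,2,\dots,N)$. For each integer $n>0$ define the positive integer $$S_n=\prod_{m=1}^{n}\ \prod_{k=0}^{\min(m-1,\,n-m)}\ \prod_{j=k+1}^{n-k}(n+m)^{\binom{n}{k}^2\frac{2d_{2n}}{j}}$$ (the exponents are integers because $j\mid d_{2n}$) and the real number $$I_n=\int_{n+1}^{\infty}\frac{(n!)^2\,\Gamma(t)}{(2n+1)\,\Gamma(2n+1+t)}\;{}_3F_2\!\left(\begin{matrix}n+1,\ n+1,\ 2n+1\\ 2n+2,\ 2n+1+t\end{matrix}\,\Big|\,1\right)dt,$$ where $${}_3F_2\!\left(\begin{matrix}a,\ b,\ c\\ d,\ e\end{matrix}\,\Big|\,z\right)=\sum_{k=0}^{\infty}\frac{(a)_k(b)_k(c)_k}{k!\,(d)_k(e)_k}z^k,\qquad (a)_0=1,\quad (a)_k=a(a+1)\cdots(a+k-1)\ \text{ for } k>0.$$ For every $n>0$ the series converges for all $t\ge n+1$ and the integral $I_n$ converges. Moreover, the following three statements are equivalent: (i) the fractional part of $\log S_n$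 is equal to $d_{2n}I_n$ for some $n>0$; (ii) the fractional part of $\log S_n$ is equal to $d_{2n}I_n$ for all sufficiently large $n$; (iii) Euler's constant $\gamma=\lim_{N\to\infty}\left(\sum_{k=1}^{N}\frac1k-\log N\right)$ is a rational number. -/

import Mathlib

/-- `d_n = LCM(1, 2, ..., n)`. -/
def lcmUpTo (n : ℕ) : ℕ := (Finset.Icc 1 n).lcm id

/-- The `k`-th term of the series defining `₃F₂(a, b, c; d, e | z)`; here `(a)_k` is the rising
factorial `a (a + 1) ⋯ (a + k - 1)`. -/
noncomputable def hyp3F2Term (a b c d e z : ℝ) (k : ℕ) : ℝ :=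
  ((ascPochhammer ℝ k).eval a * (ascPochhammer ℝ k).eval b * (ascPochhammer ℝ k).eval c) /
    ((k.factorial : ℝ) * (ascPochhammer ℝ k).eval d * (ascPochhammer ℝ k).eval e) * z ^ k

/-- The hypergeometric function `₃F₂(a, b, c; d, e | z)`. -/
noncomputable def hyp3F2 (a b c d e z : ℝ) : ℝ := ∑' k : ℕ, hyp3F2Term a b c d e z k

/-- The integer `S_n`. In every factor one has `1 ≤ j ≤ n`, so that `j` divides `d_{2n}` and the
division in the exponent is exact (`dvd_lcmUpTo`). -/
def sondowS (n : ℕ) : ℕ :=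
  ∏ m ∈ Finset.Icc 1 n, ∏ k ∈ Finset.Icc 0 (min (m - 1) (n - m)), ∏ j ∈ Finset.Icc (k + 1) (n - k),
    (n + m) ^ (n.choose k ^ 2 * (2 * lcmUpTo (2 * n) / j))

theorem dvd_lcmUpTo {j n : ℕ} (h1 : 1 ≤ j) (hn : j ≤ n) : j ∣ lcmUpTo n :=
  Finset.dvd_lcm (f := id) (Finset.mem_Icc.mpr ⟨h1, hn⟩)

theorem sondowS_pos (n : ℕ) : 0 < sondowS n := by
  unfold sondowS
  refine Finset.prod_pos fun m hm => Finset.prod_pos fun k _ => Finset.prod_pos fun j _ => ?_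
  have := (Finset.mem_Icc.mp hm).1
  exact pow_pos (by omega) _

/-- The integrand of `I_n`. -/
noncomputable def sondowIntegrand (n : ℕ) (t : ℝ) : ℝ :=
  ((n.factorial : ℝ) ^ 2 * Real.Gamma t) / ((2 * n + 1) * Real.Gamma (2 * n + 1 + t)) *
    hyp3F2 (n + 1) (n + 1) (2 * n + 1) (2 * n + 2) (2 * n + 1 + t) 1

/-- The hypergeometric integral `I_n`. -/
noncomputable def sondowI (n : ℕ) : ℝ :=
  ∫ t in Set.Ioi ((n : ℝ) + 1), sondowIntegrand n t

/-!
Write `B` for the beta function. Gauss's summation of `₂F₁` at `1` turns the integrand of `I_n` into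
`∑ ν, B(n + 1, t + ν)²`. Since `B(n + 1, t) = ∑ k, (-1)^k C(n, k) / (t + k)`, each summand has an
explicit partial fraction expansion; integrating it and summing over `ν` gives
`I_n = C(2n, n) γ - A_n + L_n`, where `d_{2n} A_n` is an integer and `d_{2n} L_n = log S_n`. Hence
`d_{2n} I_n` and `log S_n` differ by an integer exactly when `d_{2n} C(2n, n) γ` is an integer.

It remains to see that `0 < d_{2n} I_n < 1` for large `n`. The bound
`B(b + 1, t + 1) ≤ B(b, t) / 4` gives `I_{n+1} ≤ I_n / 16`, so `d_{2n}` has to grow more slowly than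
`16^n`. The central binomial coefficient alone only yields the growth rate `16`, whereas Chebyshev's
quotient `(6n)! n! / ((3n)! (2n)!²)` yields `d_{2n} ≤ C 2^(15n/4)`.
-/

open Filter Topology MeasureTheory ProbabilityTheory

/-! ### Series of beta functions -/

theorem integral_rpow_mul_one_sub_rpow {a b : ℝ} (ha : 0 < a) (hb : 0 < b) :
    ∫ x in Set.Ioo (0 : ℝ) 1, x ^ (a - 1) * (1 - x) ^ (b - 1) = beta a b := by
  have h := lintegral_betaPDF.symm.trans (lintegral_betaPDF_eq_one ha hb)
  have hβ := beta_pos ha hb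
  rw [← ENNReal.toReal_eq_one_iff, ← integral_eq_lintegral_of_nonneg_ae
    (ae_restrict_of_forall_mem measurableSet_Ioo fun x hx => ?_)
    (Measurable.aestronglyMeasurable (by fun_prop))] at h
  · simp_rw [mul_assoc, integral_const_mul] at h
    rwa [one_div, inv_mul_eq_one₀ hβ.ne', eq_comm] at h
  · have := Real.rpow_pos_of_pos hx.1 (a - 1)
    have := Real.rpow_pos_of_pos (sub_pos.2 hx.2) (b - 1)
    positivity

theorem integrableOn_rpow_mul_one_sub_rpow {a b : ℝ} (ha : 0 < a) (hb : 0 < b) :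
    IntegrableOn (fun x : ℝ => x ^ (a - 1) * (1 - x) ^ (b - 1)) (Set.Ioo 0 1) :=
  Integrable.of_integral_ne_zero <|
    (integral_rpow_mul_one_sub_rpow ha hb).trans_ne (beta_pos ha hb).ne'

theorem choose_add_sub_one_eq_ascPochhammer (a : ℝ) (k : ℕ) :
    Ring.choose (a + k - 1) k = (ascPochhammer ℝ k).eval a / k.factorial := by
  have h := Ring.factorial_nsmul_multichoose_eq_ascPochhammer a k
  rw [Polynomial.ascPochhammer_smeval_eq_eval, nsmul_eq_mul] at h
  rw [← Ring.multichoose_eq, ← h]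
  field_simp

theorem hasSum_ascPochhammer_mul_pow (a : ℝ) {x : ℝ} (hx : |x| < 1) :
    HasSum (fun k : ℕ => (ascPochhammer ℝ k).eval a / k.factorial * x ^ k) ((1 - x) ^ (-a)) := by
  have hx' : x ∈ Metric.eball (0 : ℝ) 1 := by simpa [enorm_eq_nnnorm] using! hx
  have h := (Real.one_div_one_sub_rpow_hasFPowerSeriesOnBall_zero a).hasSum hx'
  rw [zero_add, one_div, ← Real.rpow_neg (by linarith [le_abs_self x])] at h
  refine h.congr_fun fun k => ?_
  simp [choose_add_sub_one_eq_ascPochhammer, mul_comm]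

theorem hasSum_ascPochhammer_mul_beta {a b c : ℝ} (ha : 0 < a) (hb : 0 < b) (hc : 0 < c) :
    HasSum (fun k : ℕ => (ascPochhammer ℝ k).eval a / k.factorial * beta (b + k) (c + a))
      (beta b c) := by
  have hlim : ∀ x ∈ Set.Ioo (0 : ℝ) 1, HasSum
      (fun k : ℕ => (ascPochhammer ℝ k).eval a / k.factorial *
        (x ^ (b + k - 1) * (1 - x) ^ (c + a - 1)))
      (x ^ (b - 1) * (1 - x) ^ (c - 1)) := by
    intro x ⟨hx0, hx1⟩
    have hx1' : 0 < 1 - x := sub_pos.2 hx1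
    convert! (hasSum_ascPochhammer_mul_pow a (abs_lt.2 ⟨by linarith, hx1⟩)).mul_left
      (x ^ (b - 1) * (1 - x) ^ (c + a - 1)) using 1
    · funext k
      rw [add_sub_right_comm, Real.rpow_add_natCast hx0.ne']
      ring
    · rw [mul_assoc, ← Real.rpow_add hx1']
      ring_nf
  have hnonneg (k : ℕ) : 0 ≤ (ascPochhammer ℝ k).eval a / k.factorial :=
    div_nonneg (ascPochhammer_pos k a ha).le (Nat.cast_nonneg _)
  have h := hasSum_integral_of_dominated_convergence (μ := volume.restrict (Set.Ioo 0 1))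
    (fun (k : ℕ) (x : ℝ) => (ascPochhammer ℝ k).eval a / k.factorial *
        (x ^ (b + k - 1) * (1 - x) ^ (c + a - 1)))
    (fun k => Measurable.aestronglyMeasurable (by fun_prop))
    (fun k => ae_restrict_of_forall_mem measurableSet_Ioo fun x hx => (Real.norm_of_nonneg ?_).le)
    (ae_restrict_of_forall_mem measurableSet_Ioo fun x hx => (hlim x hx).summable)
    (IntegrableOn.congr_fun (integrableOn_rpow_mul_one_sub_rpow hb hc)
      (fun x hx => (hlim x hx).tsum_eq.symm) measurableSet_Ioo)
    (ae_restrict_of_forall_mem measurableSet_Ioo hlim)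
  · rw [integral_rpow_mul_one_sub_rpow hb hc] at h
    refine h.congr_fun fun k => ?_
    rw [integral_const_mul, integral_rpow_mul_one_sub_rpow (by positivity) (by positivity)]
  · have := hnonneg k
    have := Real.rpow_pos_of_pos hx.1 (b + k - 1)
    have := Real.rpow_pos_of_pos (sub_pos.2 hx.2) (c + a - 1)
    positivity

theorem hasSum_beta_add_natCast {b c : ℝ} (hb : 0 < b) (hc : 0 < c) :
    HasSum (fun ν : ℕ => beta (b + ν) (c + 1)) (beta b c) := by
  refine (hasSum_ascPochhammer_mul_beta one_pos hb hc).congr_fun fun ν => ?_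
  rw [ascPochhammer_eval_one, div_self (by positivity), one_mul]

theorem beta_one_left {x : ℝ} (hx : 0 < x) : beta 1 x = x⁻¹ := by
  have hΓ := (Real.Gamma_pos_of_pos hx).ne'
  rw [beta, Real.Gamma_one, add_comm, Real.Gamma_add_one hx.ne']
  field_simp

theorem beta_le_inv {a x : ℝ} (ha : 1 ≤ a) (hx : 0 < x) : beta a x ≤ x⁻¹ := by
  have ha0 := one_pos.trans_le ha
  rw [← beta_one_left hx, ← integral_rpow_mul_one_sub_rpow ha0 hx,
    ← integral_rpow_mul_one_sub_rpow one_pos hx]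
  refine setIntegral_mono_on (integrableOn_rpow_mul_one_sub_rpow ha0 hx)
    (integrableOn_rpow_mul_one_sub_rpow one_pos hx) measurableSet_Ioo fun y hy => ?_
  have h1 : (0 : ℝ) < 1 - y := sub_pos.2 hy.2
  gcongr ?_ * _
  exact Real.rpow_le_rpow_of_exponent_ge hy.1 hy.2.le (by linarith)

theorem beta_mul_beta_add_left {a b c : ℝ} (hab : 0 < a + b) (hca : 0 < c + a) :
    beta a c * beta b (c + a) = beta a b * beta c (a + b) := by
  have h1 := (Real.Gamma_pos_of_pos hab).ne'
  have h2 := (Real.Gamma_pos_of_pos hca).ne'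
  rw [beta, beta, beta, beta, add_comm a c, show b + (c + a) = c + (a + b) by ring]
  field_simp

theorem Gamma_add_natCast {x : ℝ} (hx : 0 < x) (k : ℕ) :
    Real.Gamma (x + k) = (ascPochhammer ℝ k).eval x * Real.Gamma x := by
  induction k with
  | zero => simp
  | succ k ih =>
    rw [Nat.cast_succ, ← add_assoc, Real.Gamma_add_one (by positivity), ih,
      ascPochhammer_succ_eval]
    ring

theorem hasSum_of_hasSum_rows_of_hasSum_columns {α β : Type*} {f : α → β → ℝ} {g : α → ℝ}
    {h : β → ℝ} (hf : ∀ a b, 0 ≤ f a b) (hrow : ∀ a, HasSum (f a) (g a))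
    (hcol : ∀ b, HasSum (fun a => f a b) (h b)) (hg : Summable g) : HasSum h (∑' a, g a) := by
  have hS : Summable (fun p : α × β => f p.1 p.2) := by
    refine (summable_prod_of_nonneg fun p => hf p.1 p.2).2 ⟨fun a => (hrow a).summable, ?_⟩
    simpa only [(hrow _).tsum_eq] using hg
  have hrows : HasSum g (∑' p : α × β, f p.1 p.2) := hS.hasSum.prod_fiberwise hrow
  have hcols := ((Equiv.prodComm β α).hasSum_iff.2 hS.hasSum).prod_fiberwise hcol
  rwa [hrows.tsum_eq]

theorem summable_beta_mul_beta {a b t : ℝ} (ha : 1 ≤ a) (hb : 1 ≤ b) (ht : 0 < t) :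
    Summable fun ν : ℕ => beta a (t + ν) * beta b (t + ν) := by
  have hpos (ν : ℕ) : 0 < t + ν := by positivity
  have ha0 := one_pos.trans_le ha
  have hb0 := one_pos.trans_le hb
  have hsum : Summable fun ν : ℕ => ((t + ν) ^ 2)⁻¹ := by
    simpa [abs_of_pos (hpos _), add_comm] using
      (Real.summable_one_div_nat_add_rpow t 2).2 one_lt_two
  refine hsum.of_nonneg_of_le
    (fun ν => (mul_pos (beta_pos ha0 (hpos ν)) (beta_pos hb0 (hpos ν))).le) fun ν => ?_
  rw [sq, mul_inv]
  gcongr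
  · exact (beta_pos hb0 (hpos ν)).le
  · exact beta_le_inv ha (hpos ν)
  · exact beta_le_inv hb (hpos ν)

-- Gauss's summation expands each `B(b, t + ν)`; the sum over `ν` is then taken first.
theorem hasSum_ascPochhammer_mul_beta_mul_beta {a b t : ℝ} (ha : 1 ≤ a) (hb : 1 ≤ b)
    (ht : 0 < t) :
    HasSum (fun k : ℕ => (ascPochhammer ℝ k).eval a / k.factorial *
        (beta a (b + k) * beta t (a + b + k - 1)))
      (∑' ν : ℕ, beta a (t + ν) * beta b (t + ν)) := by
  have ha0 := one_pos.trans_le ha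
  have hb0 := one_pos.trans_le hb
  have hpos (ν : ℕ) : 0 < t + ν := by positivity
  refine hasSum_of_hasSum_rows_of_hasSum_columns (f := fun ν k : ℕ => beta a (t + ν) *
      ((ascPochhammer ℝ k).eval a / k.factorial * beta (b + k) (t + ν + a)))
    (fun ν k => ?_)
    (fun ν => (hasSum_ascPochhammer_mul_beta ha0 hb0 (hpos ν)).mul_left _)
    (fun k => ?_) (summable_beta_mul_beta ha hb ht)
  · have := ascPochhammer_pos k a ha0
    have := beta_pos ha0 (hpos ν)
    have := beta_pos (show 0 < b + k by positivity) (show 0 < t + ν + a by positivity)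
    positivity
  · have hc : 0 < a + b + k - 1 := by linarith [k.cast_nonneg (α := ℝ)]
    refine (((hasSum_beta_add_natCast ht hc).mul_left (beta a (b + k))).mul_left
      ((ascPochhammer ℝ k).eval a / k.factorial)).congr_fun fun ν => ?_
    rw [mul_left_comm, beta_mul_beta_add_left (by positivity) (by positivity), sub_add_cancel,
      add_assoc a b]

/-! ### The hypergeometric integrand -/

theorem Gamma_mul_hyp3F2Term {a b t : ℝ} (ha : 1 ≤ a) (hb : 1 ≤ b) (ht : 0 < t) (k : ℕ) :
    Real.Gamma a * Real.Gamma b * Real.Gamma t / ((a + b - 1) * Real.Gamma (a + b - 1 + t)) *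
        hyp3F2Term a b (a + b - 1) (a + b) (a + b - 1 + t) 1 k =
      (ascPochhammer ℝ k).eval a / k.factorial *
        (beta a (b + k) * beta t (a + b + k - 1)) := by
  have hs : 0 < a + b - 1 := by linarith
  have hb0 : 0 < b := by linarith
  have hab : 0 < a + b := by linarith
  have hst : 0 < a + b - 1 + t := by positivity
  have h1 := (ascPochhammer_pos k _ hab).ne'
  have h2 := (ascPochhammer_pos k _ hst).ne'
  have h3 := (Real.Gamma_pos_of_pos hs).ne'
  have h4 := (Real.Gamma_pos_of_pos hst).ne'
  have hΓ : Real.Gamma (a + b) = (a + b - 1) * Real.Gamma (a + b - 1) := by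
    rw [← Real.Gamma_add_one hs.ne', sub_add_cancel]
  rw [hyp3F2Term, beta, beta, Gamma_add_natCast hb0, ← add_assoc, Gamma_add_natCast hab, hΓ,
    show a + b + k - 1 = a + b - 1 + k by ring, Gamma_add_natCast hs,
    show t + (a + b - 1 + k) = a + b - 1 + t + k by ring, Gamma_add_natCast hst, one_pow]
  field_simp

theorem hasSum_Gamma_mul_hyp3F2Term {a b t : ℝ} (ha : 1 ≤ a) (hb : 1 ≤ b) (ht : 0 < t) :
    HasSum (fun k => Real.Gamma a * Real.Gamma b * Real.Gamma t /
        ((a + b - 1) * Real.Gamma (a + b - 1 + t)) *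
          hyp3F2Term a b (a + b - 1) (a + b) (a + b - 1 + t) 1 k)
      (∑' ν : ℕ, beta a (t + ν) * beta b (t + ν)) := by
  simp only [Gamma_mul_hyp3F2Term ha hb ht]
  exact hasSum_ascPochhammer_mul_beta_mul_beta ha hb ht

theorem hasSum_sondowIntegrand (n : ℕ) {t : ℝ} (ht : 0 < t) :
    HasSum (fun k => (n.factorial : ℝ) ^ 2 * Real.Gamma t /
        ((2 * n + 1) * Real.Gamma (2 * n + 1 + t)) *
          hyp3F2Term (n + 1) (n + 1) (2 * n + 1) (2 * n + 2) (2 * n + 1 + t) 1 k)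
      (∑' ν : ℕ, beta (n + 1) (t + ν) ^ 2) := by
  have hn : (1 : ℝ) ≤ n + 1 := by linarith [n.cast_nonneg (α := ℝ)]
  have h := hasSum_Gamma_mul_hyp3F2Term hn hn ht
  rw [Real.Gamma_nat_eq_factorial, show (n : ℝ) + 1 + (n + 1) - 1 = 2 * n + 1 by ring,
    show (n : ℝ) + 1 + (n + 1) = 2 * n + 2 by ring] at h
  simpa only [← sq] using h

theorem summable_hyp3F2Term (n : ℕ) {t : ℝ} (ht : 0 < t) :
    Summable (hyp3F2Term (n + 1) (n + 1) (2 * n + 1) (2 * n + 2) (2 * n + 1 + t) 1) := by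
  have := Real.Gamma_pos_of_pos ht
  have := Real.Gamma_pos_of_pos (show 0 < 2 * n + 1 + t by positivity)
  exact (summable_mul_left_iff (by positivity)).1 (hasSum_sondowIntegrand n ht).summable

theorem sondowIntegrand_eq_tsum (n : ℕ) {t : ℝ} (ht : 0 < t) :
    sondowIntegrand n t = ∑' ν : ℕ, beta (n + 1) (t + ν) ^ 2 := by
  rw [sondowIntegrand, hyp3F2, ← tsum_mul_left]
  exact (hasSum_sondowIntegrand n ht).tsum_eq

/-! ### Partial fractions -/

section PartialFractions

variable {ι K : Type*} [Field K] {s : Finset ι} {x : ι → K}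

theorem sq_sum_div_add (hx : Set.InjOn x s) (c : ι → K) {t : K} (ht : ∀ i ∈ s, t + x i ≠ 0) :
    (∑ i ∈ s, c i / (t + x i)) ^ 2 = ∑ i ∈ s,
      (c i ^ 2 / (t + x i) ^ 2 + 2 * c i * (∑ j ∈ s, c j / (x j - x i)) / (t + x i)) := by
  classical
  have hpair : ∀ i ∈ s, ∀ j ∈ s, c i / (t + x i) * (c j / (t + x j)) =
      (if i = j then c i ^ 2 / (t + x i) ^ 2 else 0) +
        (c i / (t + x i) * (c j / (x j - x i)) + c j / (t + x j) * (c i / (x i - x j))) := by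
    intro i hi j hj
    have hti := ht i hi
    have htj := ht j hj
    split_ifs with h
    · subst h
      simp [div_mul_div_comm, sq]
    · have hij : x i - x j ≠ 0 := sub_ne_zero.2 (hx.ne hi hj h)
      have hji : x j - x i ≠ 0 := sub_ne_zero.2 (hx.ne hj hi (Ne.symm h))
      field_simp
      ring
  have hdiag : ∑ i ∈ s, ∑ j ∈ s, (if i = j then c i ^ 2 / (t + x i) ^ 2 else 0) =
      ∑ i ∈ s, c i ^ 2 / (t + x i) ^ 2 :=
    Finset.sum_congr rfl fun i hi => by rw [Finset.sum_ite_eq, if_pos hi]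
  rw [sq, Finset.sum_mul_sum,
    Finset.sum_congr rfl fun i hi => Finset.sum_congr rfl fun j hj => hpair i hi j hj]
  simp only [Finset.sum_add_distrib, hdiag]
  rw [Finset.sum_comm (f := fun i j => c j / (t + x j) * (c i / (x i - x j))), ← two_mul,
    Finset.mul_sum]
  congr 1
  refine Finset.sum_congr rfl fun i _ => ?_
  rw [← Finset.mul_sum]
  ring

theorem sum_mul_two_mul_sum_div_sub (hx : Set.InjOn x s) (c : ι → K) :
    ∑ i ∈ s, x i * (2 * c i * ∑ j ∈ s, c j / (x j - x i)) =
      ∑ i ∈ s, c i ^ 2 - (∑ i ∈ s, c i) ^ 2 := by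
  classical
  have hpair : ∀ i ∈ s, ∀ j ∈ s,
      x i * (c i * (c j / (x j - x i))) + x j * (c j * (c i / (x i - x j))) =
        (if i = j then c i ^ 2 else 0) - c i * c j := by
    intro i hi j hj
    split_ifs with h
    · subst h
      simp [sq]
    · have hij : x i - x j ≠ 0 := sub_ne_zero.2 (hx.ne hi hj h)
      have hji : x j - x i ≠ 0 := sub_ne_zero.2 (hx.ne hj hi (Ne.symm h))
      field_simp
      ring
  have hdiag : ∑ i ∈ s, ∑ j ∈ s, (if i = j then c i ^ 2 else 0) = ∑ i ∈ s, c i ^ 2 :=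
    Finset.sum_congr rfl fun i hi => by rw [Finset.sum_ite_eq, if_pos hi]
  calc ∑ i ∈ s, x i * (2 * c i * ∑ j ∈ s, c j / (x j - x i))
      = ∑ i ∈ s, ∑ j ∈ s, x i * (c i * (c j / (x j - x i))) +
          ∑ i ∈ s, ∑ j ∈ s, x j * (c j * (c i / (x i - x j))) := by
        rw [Finset.sum_comm (f := fun i j => x j * (c j * (c i / (x i - x j)))), ← two_mul,
          Finset.mul_sum]
        refine Finset.sum_congr rfl fun i _ => ?_
        rw [← Finset.mul_sum, ← Finset.mul_sum]
        ring
    _ = ∑ i ∈ s, ∑ j ∈ s, ((if i = j then c i ^ 2 else 0) - c i * c j) := by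
        simp only [← Finset.sum_add_distrib]
        exact Finset.sum_congr rfl fun i hi => Finset.sum_congr rfl fun j hj => hpair i hi j hj
    _ = ∑ i ∈ s, c i ^ 2 - (∑ i ∈ s, c i) ^ 2 := by
        simp only [Finset.sum_sub_distrib, hdiag, ← Finset.sum_mul_sum, ← sq]

end PartialFractions

/-- The signed binomial coefficient `(-1)^k C(n, k)`. -/
noncomputable def altChoose (n k : ℕ) : ℝ := (-1) ^ k * (n.choose k : ℝ)

theorem altChoose_sq (n k : ℕ) : altChoose n k ^ 2 = (n.choose k : ℝ) ^ 2 := by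
  rw [altChoose, mul_pow, pow_right_comm, neg_one_sq, one_pow, one_mul]

theorem altChoose_reflect {n k : ℕ} (hk : k ≤ n) :
    altChoose n (n - k) = (-1) ^ n * altChoose n k := by
  have hsign : (-1 : ℝ) ^ (n - k) = (-1) ^ n * (-1) ^ k := by
    rw [← Nat.add_sub_of_le hk, add_tsub_cancel_left, pow_add, mul_right_comm, ← mul_pow]
    simp
  rw [altChoose, altChoose, Nat.choose_symm hk, hsign, mul_assoc]

theorem succ_sub_mul_altChoose_succ {n k : ℕ} (hk : k ≤ n + 1) :
    ((n : ℝ) + 1 - k) * altChoose (n + 1) k = (n + 1) * altChoose n k := by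
  have h : (n.choose k : ℝ) * (n + 1) = (n + 1).choose k * (n + 1 - k) := by
    have h := congrArg (Nat.cast (R := ℝ)) (Nat.choose_mul_succ_eq n k)
    push_cast [Nat.cast_sub hk] at h
    exact h
  rw [altChoose, altChoose]
  linear_combination -(-1) ^ k * h

theorem sum_altChoose {n : ℕ} (hn : n ≠ 0) : ∑ k ∈ Finset.range (n + 1), altChoose n k = 0 := by
  simp only [altChoose]
  exact_mod_cast Int.alternating_sum_range_choose_of_ne hn

theorem beta_sub_beta_add_one {a t : ℝ} (ha : 0 < a) (ht : 0 < t) :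
    beta a t - beta a (t + 1) = beta (a + 1) t := by
  have h := (Real.Gamma_pos_of_pos (add_pos ha ht)).ne'
  rw [beta, beta, beta, ← add_assoc, add_right_comm a 1 t, Real.Gamma_add_one ha.ne',
    Real.Gamma_add_one ht.ne', Real.Gamma_add_one (by positivity)]
  field_simp
  ring

theorem beta_add_one_add_one_le {b t : ℝ} (hb : 0 < b) (ht : 0 < t) :
    beta (b + 1) (t + 1) ≤ beta b t / 4 := by
  have hbt := add_pos hb ht
  have := Real.Gamma_pos_of_pos hb
  have := Real.Gamma_pos_of_pos ht
  have := Real.Gamma_pos_of_pos hbt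
  have hstep : beta (b + 1) (t + 1) = beta b t * (b * t / ((b + t + 1) * (b + t))) := by
    rw [beta, beta, show b + 1 + (t + 1) = b + t + 1 + 1 by ring, Real.Gamma_add_one hb.ne',
      Real.Gamma_add_one ht.ne', Real.Gamma_add_one (by positivity), Real.Gamma_add_one hbt.ne']
    field_simp
  rw [hstep, div_eq_mul_inv (beta b t)]
  refine mul_le_mul_of_nonneg_left ?_ (beta_pos hb ht).le
  rw [div_le_iff₀ (by positivity)]
  nlinarith [sq_nonneg (b - t)]

theorem fwdDiff_iter_inv (n : ℕ) {t : ℝ} (ht : 0 < t) :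
    (fwdDiff (1 : ℝ))^[n] (fun x => x⁻¹) t = (-1) ^ n * beta (n + 1) t := by
  induction n generalizing t with
  | zero => simp [beta_one_left ht]
  | succ n ih =>
    have h := beta_sub_beta_add_one (a := n + 1) (by positivity) ht
    rw [Function.iterate_succ_apply', fwdDiff, ih (by positivity), ih ht, Nat.cast_succ, ← h]
    ring

theorem beta_natCast_add_one_eq_sum (n : ℕ) {t : ℝ} (ht : 0 < t) :
    beta (n + 1) t = ∑ k ∈ Finset.range (n + 1), altChoose n k / (t + k) := by
  have h := fwdDiff_iter_inv n ht
  rw [fwdDiff_iter_eq_sum_shift] at h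
  have hsq : (-1 : ℝ) ^ n * (-1) ^ n = 1 := by rw [← mul_pow, neg_one_mul, neg_neg, one_pow]
  rw [← one_mul (beta (n + 1) t), ← hsq, mul_assoc, hsq, ← h, Finset.mul_sum]
  refine Finset.sum_congr rfl fun k hk => ?_
  have hkn := Finset.mem_range_succ_iff.1 hk
  have hk' := altChoose_reflect (Nat.sub_le n k)
  rw [Nat.sub_sub_self hkn] at hk'
  rw [hk', altChoose, Nat.choose_symm hkn, zsmul_eq_mul, nsmul_one, div_eq_mul_inv]
  push_cast
  ring

/-- The sum `∑_{l ≠ k} (-1)^l C(n, l) / (l - k)`; the term `l = k` is `0` because of the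
convention `x / 0 = 0`. -/
noncomputable def altHarmonicSum (n k : ℕ) : ℝ :=
  ∑ l ∈ Finset.range (n + 1), altChoose n l / ((l : ℝ) - k)

theorem altHarmonicSum_succ {n k : ℕ} (hk : k ≤ n) :
    ((n : ℝ) + 1 - k) * altHarmonicSum (n + 1) k =
      (n + 1) * altHarmonicSum n k - altChoose (n + 1) k := by
  have hterm : ∀ l ∈ Finset.range (n + 2),
      ((n : ℝ) + 1 - k) * (altChoose (n + 1) l / ((l : ℝ) - k)) =
        (n + 1) * (altChoose n l / ((l : ℝ) - k)) +
          (altChoose (n + 1) l - if k = l then altChoose (n + 1) l else 0) := by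
    intro l hl
    have h := succ_sub_mul_altChoose_succ (Finset.mem_range_succ_iff.1 hl)
    split_ifs with hkl
    · simp [hkl]
    · have hne : (l : ℝ) - k ≠ 0 := sub_ne_zero.2 (Nat.cast_injective.ne (Ne.symm hkl))
      field_simp
      linear_combination h
  have hlast : altChoose n (n + 1) = 0 := by simp [altChoose]
  rw [altHarmonicSum, altHarmonicSum, Finset.mul_sum, Finset.sum_congr rfl hterm,
    Finset.sum_add_distrib, Finset.sum_sub_distrib, sum_altChoose n.succ_ne_zero,
    Finset.sum_ite_eq, if_pos (Finset.mem_range.2 (by omega)), ← Finset.mul_sum,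
    Finset.sum_range_succ _ (n + 1), hlast]
  ring

theorem altHarmonicSum_reflect {n k : ℕ} (hk : k ≤ n) :
    altHarmonicSum n (n - k) = -((-1) ^ n * altHarmonicSum n k) := by
  rw [altHarmonicSum, ← Finset.sum_range_reflect, altHarmonicSum, Finset.mul_sum,
    ← Finset.sum_neg_distrib]
  refine Finset.sum_congr rfl fun l hl => ?_
  have hl' := Finset.mem_range_succ_iff.1 hl
  rw [Nat.add_sub_cancel, altChoose_reflect hl', Nat.cast_sub hl', Nat.cast_sub hk,
    sub_sub_sub_cancel_left, ← neg_sub (l : ℝ) k, div_neg, mul_div_assoc]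

theorem altHarmonicSum_eq_of_self {n k : ℕ} (hk : k ≤ n)
    (hself : altHarmonicSum k k = altChoose k k * (harmonic k : ℝ)) :
    altHarmonicSum n k = altChoose n k * ((harmonic k : ℝ) - harmonic (n - k)) := by
  induction n, hk using Nat.le_induction with
  | base => simpa using hself
  | succ n hk ih =>
    have hne : (n : ℝ) + 1 - k ≠ 0 := by
      have : (k : ℝ) ≤ n := Nat.cast_le.2 hk
      linarith
    have hrec := altHarmonicSum_succ hk
    have hchoose := succ_sub_mul_altChoose_succ (Nat.le_succ_of_le hk)
    refine mul_left_cancel₀ hne ?_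
    rw [hrec, ih, Nat.succ_sub hk, harmonic_succ]
    push_cast [Nat.cast_sub hk]
    rw [sub_add_eq_add_sub]
    field_simp
    linear_combination (-((harmonic k : ℝ) - harmonic (n - k))) * hchoose

-- The diagonal case `n = k` is the reflection of the case `k = 0`, which the recursion provides.
theorem altHarmonicSum_eq {n k : ℕ} (hk : k ≤ n) :
    altHarmonicSum n k = altChoose n k * ((harmonic k : ℝ) - harmonic (n - k)) := by
  refine altHarmonicSum_eq_of_self hk ?_
  have hzero := altHarmonicSum_eq_of_self k.zero_le (by simp [altHarmonicSum])
  have hreflect := altHarmonicSum_reflect k.zero_le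
  rw [Nat.sub_zero] at hreflect
  rw [hreflect, hzero]
  simp [altChoose]

/-- The coefficient of `1 / (t + k)` in the partial fraction expansion of `B(n + 1, t)²`. -/
noncomputable def logCoeff (n k : ℕ) : ℝ :=
  2 * (n.choose k : ℝ) ^ 2 * ((harmonic k : ℝ) - harmonic (n - k))

theorem logCoeff_eq {n k : ℕ} (hk : k ≤ n) :
    logCoeff n k = 2 * altChoose n k * altHarmonicSum n k := by
  rw [altHarmonicSum_eq hk, logCoeff, ← altChoose_sq]
  ring

theorem logCoeff_reflect {n k : ℕ} (hk : k ≤ n) : logCoeff n (n - k) = -logCoeff n k := by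
  rw [logCoeff, logCoeff, Nat.choose_symm hk, Nat.sub_sub_self hk]
  ring

theorem sq_beta_natCast_add_one_eq_sum (n : ℕ) {t : ℝ} (ht : 0 < t) :
    beta (n + 1) t ^ 2 = ∑ k ∈ Finset.range (n + 1),
      ((n.choose k : ℝ) ^ 2 / (t + k) ^ 2 + logCoeff n k / (t + k)) := by
  rw [beta_natCast_add_one_eq_sum n ht, sq_sum_div_add Nat.cast_injective.injOn]
  · refine Finset.sum_congr rfl fun k hk => ?_
    rw [logCoeff_eq (Finset.mem_range_succ_iff.1 hk), altChoose_sq, altHarmonicSum]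
  · exact fun k _ => by positivity

theorem sum_Ico_logCoeff (n a : ℕ) : ∑ k ∈ Finset.Ico a (n + 1 - a), logCoeff n k = 0 := by
  rcases le_total (n + 1 - a) a with ha | ha
  · rw [Finset.Ico_eq_empty_of_le ha, Finset.sum_empty]
  have h := Finset.sum_Ico_reflect (logCoeff n) a (Nat.sub_le (n + 1) a)
  rw [Nat.sub_sub_self (by omega), Finset.sum_congr rfl fun k hk =>
    logCoeff_reflect (show k ≤ n by have := Finset.mem_Ico.1 hk; omega),
    Finset.sum_neg_distrib] at h
  exact self_eq_neg.1 h.symm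

theorem sum_logCoeff (n : ℕ) : ∑ k ∈ Finset.range (n + 1), logCoeff n k = 0 := by
  rw [Finset.range_eq_Ico]
  exact sum_Ico_logCoeff n 0

theorem sum_sq_choose (n : ℕ) :
    ∑ k ∈ Finset.range (n + 1), (n.choose k : ℝ) ^ 2 = n.centralBinom := by
  exact_mod_cast Nat.sum_range_choose_sq n

theorem sum_mul_logCoeff {n : ℕ} (hn : n ≠ 0) :
    ∑ k ∈ Finset.range (n + 1), (k : ℝ) * logCoeff n k = n.centralBinom := by
  have h := sum_mul_two_mul_sum_div_sub (s := Finset.range (n + 1)) (x := (Nat.cast : ℕ → ℝ))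
    (Set.injOn_of_injective Nat.cast_injective) (altChoose n)
  simp only [sum_altChoose hn, altChoose_sq, sum_sq_choose, ne_eq, OfNat.ofNat_ne_zero,
    not_false_eq_true, zero_pow, sub_zero] at h
  rw [← h]
  refine Finset.sum_congr rfl fun k hk => ?_
  rw [logCoeff_eq (Finset.mem_range_succ_iff.1 hk), altHarmonicSum]

/-- The primitive of `t ↦ B(n + 1, t)²` on the positive half-line that vanishes at infinity. -/
noncomputable def sqBetaPrimitive (n : ℕ) (t : ℝ) : ℝ :=
  ∑ k ∈ Finset.range (n + 1),
    (-((n.choose k : ℝ) ^ 2 / (t + k)) + logCoeff n k * Real.log (t + k))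

theorem hasDerivAt_sqBetaPrimitive (n : ℕ) {t : ℝ} (ht : 0 < t) :
    HasDerivAt (sqBetaPrimitive n) (beta (n + 1) t ^ 2) t := by
  rw [sq_beta_natCast_add_one_eq_sum n ht]
  refine HasDerivAt.fun_sum fun k _ => ?_
  have hk : t + k ≠ 0 := by positivity
  have hadd : HasDerivAt (fun t : ℝ => t + k) 1 t := (hasDerivAt_id t).add_const _
  have hinv := ((hadd.inv hk).const_mul ((n.choose k : ℝ) ^ 2)).neg
  have hlog := (hadd.log hk).const_mul (logCoeff n k)
  convert! hinv.add hlog using 1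
  field_simp

theorem tendsto_sqBetaPrimitive (n : ℕ) : Tendsto (sqBetaPrimitive n) atTop (𝓝 0) := by
  have hterm (k : ℕ) : Tendsto (fun t : ℝ => -((n.choose k : ℝ) ^ 2 / (t + k)) +
      logCoeff n k * (Real.log (t + k) - Real.log t)) atTop (𝓝 0) := by
    have hadd : Tendsto (fun t : ℝ => t + k) atTop atTop :=
      tendsto_atTop_add_const_right _ _ tendsto_id
    simpa using (hadd.const_div_atTop ((n.choose k : ℝ) ^ 2)).neg.add
      ((Real.tendsto_log_comp_add_sub_log k).const_mul (logCoeff n k))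
  have hsum := tendsto_finsetSum (Finset.range (n + 1)) fun k _ => hterm k
  rw [Finset.sum_const_zero] at hsum
  refine hsum.congr fun t => ?_
  simp only [sqBetaPrimitive, mul_sub, Finset.sum_add_distrib, Finset.sum_sub_distrib]
  rw [← Finset.sum_mul, sum_logCoeff, zero_mul, sub_zero]

section IntegralSqBeta

variable (n : ℕ) {a ν : ℝ}

theorem hasDerivAt_sqBetaPrimitive_add (ha : 0 < a) (hν : 0 ≤ ν) :
    ∀ t ∈ Set.Ici a, HasDerivAt (fun t => sqBetaPrimitive n (t + ν)) (beta (n + 1) (t + ν) ^ 2) t :=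
  fun t ht => (hasDerivAt_sqBetaPrimitive n
    (add_pos_of_pos_of_nonneg (ha.trans_le ht) hν)).comp_add_const t ν

theorem tendsto_sqBetaPrimitive_add (ν : ℝ) :
    Tendsto (fun t => sqBetaPrimitive n (t + ν)) atTop (𝓝 0) :=
  (tendsto_sqBetaPrimitive n).comp (tendsto_atTop_add_const_right _ _ tendsto_id)

theorem integrableOn_sq_beta_add (ha : 0 < a) (hν : 0 ≤ ν) :
    IntegrableOn (fun t => beta (n + 1) (t + ν) ^ 2) (Set.Ioi a) :=
  integrableOn_Ioi_deriv_of_nonneg' (hasDerivAt_sqBetaPrimitive_add n ha hν)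
    (fun _ _ => sq_nonneg _) (tendsto_sqBetaPrimitive_add n ν)

theorem integral_sq_beta_add (ha : 0 < a) (hν : 0 ≤ ν) :
    ∫ t in Set.Ioi a, beta (n + 1) (t + ν) ^ 2 = -sqBetaPrimitive n (a + ν) := by
  rw [integral_Ioi_of_hasDerivAt_of_nonneg' (hasDerivAt_sqBetaPrimitive_add n ha hν)
    (fun _ _ => sq_nonneg _) (tendsto_sqBetaPrimitive_add n ν), zero_sub]

theorem sqBetaPrimitive_neg (ha : 0 < a) : sqBetaPrimitive n a < 0 := by
  have hint := integral_sq_beta_add n ha le_rfl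
  have hpos : 0 < ∫ t in Set.Ioi a, beta (n + 1) (t + 0) ^ 2 := by
    refine (setIntegral_pos_iff_support_of_nonneg_ae (ae_of_all _ fun _ => sq_nonneg _)
      (integrableOn_sq_beta_add n ha le_rfl)).2 ?_
    have hsupp : Set.Ioi a ⊆ Function.support fun t => beta (n + 1) (t + 0) ^ 2 := fun t ht =>
      (pow_pos (beta_pos (by positivity) (by simpa using ha.trans ht)) 2).ne'
    rw [Set.inter_eq_right.2 hsupp, Real.volume_Ioi]
    exact ENNReal.zero_lt_top
  rw [hint, add_zero] at hpos
  exact neg_pos.1 hpos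

theorem neg_sqBetaPrimitive_succ_le (ha : 0 < a) :
    -sqBetaPrimitive (n + 1) (a + 1) ≤ -sqBetaPrimitive n a / 16 := by
  have hint := integral_sq_beta_add n ha le_rfl
  rw [add_zero] at hint
  rw [← integral_sq_beta_add (n + 1) ha zero_le_one, ← hint, ← integral_div]
  refine setIntegral_mono_on (integrableOn_sq_beta_add (n + 1) ha zero_le_one)
    ((integrableOn_sq_beta_add n ha le_rfl).div_const _) measurableSet_Ioi fun t ht => ?_
  have ht0 : 0 < t := ha.trans ht
  have hle := beta_add_one_add_one_le (b := n + 1) (by positivity) ht0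
  have h0 := beta_pos (α := n + 1 + 1) (by positivity) (add_pos ht0 one_pos)
  calc beta ((n + 1 : ℕ) + 1) (t + 1) ^ 2 ≤ (beta (n + 1) t / 4) ^ 2 := by
        push_cast
        exact pow_le_pow_left₀ h0.le hle 2
    _ = beta (n + 1) (t + 0) ^ 2 / 16 := by
        rw [add_zero, div_pow]
        norm_num

end IntegralSqBeta

/-! ### The linear form in `1`, `γ` and logarithms -/

/-- The rational part `A` of the linear form `sondowI n = C(2n, n) γ - A + L`. -/
noncomputable def sondowA (n : ℕ) : ℝ :=
  ∑ k ∈ Finset.range (n + 1), (n.choose k : ℝ) ^ 2 * (harmonic (n + k) : ℝ)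

/-- The logarithmic part `L` of the linear form `sondowI n = C(2n, n) γ - A + L`. -/
noncomputable def sondowL (n : ℕ) : ℝ :=
  ∑ k ∈ Finset.range (n + 1), logCoeff n k * Real.log ((n + k).factorial : ℝ)

theorem tendsto_harmonic_add_sub_log (k : ℕ) :
    Tendsto (fun N : ℕ => (harmonic (N + k) : ℝ) - Real.log N) atTop
      (𝓝 Real.eulerMascheroniConstant) := by
  have hharmonic := Real.tendsto_harmonic_sub_log.comp (tendsto_add_atTop_nat k)
  have hlog := (Real.tendsto_log_comp_add_sub_log k).comp tendsto_natCast_atTop_atTop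
  have h := hharmonic.add hlog
  rw [add_zero] at h
  refine h.congr fun N => ?_
  simp only [Function.comp_apply]
  push_cast
  ring

theorem log_factorial_succ (n : ℕ) :
    Real.log ((n + 1).factorial : ℝ) = Real.log (n + 1) + Real.log (n.factorial : ℝ) := by
  rw [Nat.factorial_succ, Nat.cast_mul, Real.log_mul (by positivity) (by positivity),
    Nat.cast_succ]

theorem tendsto_log_factorial_add (k : ℕ) :
    Tendsto (fun N : ℕ => Real.log ((N + k).factorial : ℝ) - Real.log (N.factorial : ℝ) -
      k * Real.log N) atTop (𝓝 0) := by
  induction k with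
  | zero => simp
  | succ k ih =>
    have h := ih.add ((Real.tendsto_log_comp_add_sub_log ((k + 1 : ℕ) : ℝ)).comp
      (tendsto_natCast_atTop_atTop (R := ℝ)))
    rw [add_zero] at h
    refine h.congr fun N => ?_
    rw [← add_assoc, log_factorial_succ, Function.comp_apply]
    push_cast
    rw [add_assoc (N : ℝ)]
    ring

theorem sum_neg_sqBetaPrimitive (n M : ℕ) :
    ∑ ν ∈ Finset.range M, -sqBetaPrimitive n ((n : ℝ) + 1 + ν) =
      (∑ k ∈ Finset.range (n + 1), ((n.choose k : ℝ) ^ 2 * (harmonic (M + n + k) : ℝ) -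
        logCoeff n k * Real.log ((M + n + k).factorial : ℝ))) - sondowA n + sondowL n := by
  induction M with
  | zero => simp [sondowA, sondowL, Finset.sum_sub_distrib]
  | succ M ih =>
    have hstep (k : ℕ) :
        (n.choose k : ℝ) ^ 2 * (harmonic (M + 1 + n + k) : ℝ) -
          logCoeff n k * Real.log ((M + 1 + n + k).factorial : ℝ) =
        ((n.choose k : ℝ) ^ 2 * (harmonic (M + n + k) : ℝ) -
          logCoeff n k * Real.log ((M + n + k).factorial : ℝ)) +
        -(-((n.choose k : ℝ) ^ 2 / ((n : ℝ) + 1 + M + k)) +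
          logCoeff n k * Real.log ((n : ℝ) + 1 + M + k)) := by
      rw [show M + 1 + n + k = M + n + k + 1 by ring, harmonic_succ, log_factorial_succ]
      push_cast
      rw [show (M : ℝ) + n + k + 1 = n + 1 + M + k by ring]
      ring
    rw [Finset.sum_range_succ, ih, sqBetaPrimitive, ← Finset.sum_neg_distrib]
    simp only [hstep, Finset.sum_add_distrib]
    ring

theorem tendsto_sum_harmonic_sub_log_factorial {n : ℕ} (hn : n ≠ 0) :
    Tendsto (fun N : ℕ => ∑ k ∈ Finset.range (n + 1),
        ((n.choose k : ℝ) ^ 2 * (harmonic (N + k) : ℝ) -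
          logCoeff n k * Real.log ((N + k).factorial : ℝ)))
      atTop (𝓝 (n.centralBinom * Real.eulerMascheroniConstant)) := by
  have hlim := tendsto_finsetSum (Finset.range (n + 1)) fun k _ =>
    ((tendsto_harmonic_add_sub_log k).const_mul ((n.choose k : ℝ) ^ 2)).sub
      ((tendsto_log_factorial_add k).const_mul (logCoeff n k))
  simp only [mul_zero, sub_zero, ← Finset.sum_mul, sum_sq_choose] at hlim
  refine hlim.congr fun N => ?_
  have hexpand (k : ℕ) :
      (n.choose k : ℝ) ^ 2 * ((harmonic (N + k) : ℝ) - Real.log N) - logCoeff n k *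
        (Real.log ((N + k).factorial : ℝ) - Real.log (N.factorial : ℝ) - k * Real.log N) =
      ((n.choose k : ℝ) ^ 2 * (harmonic (N + k) : ℝ) -
        logCoeff n k * Real.log ((N + k).factorial : ℝ)) +
      (logCoeff n k * Real.log (N.factorial : ℝ) + k * logCoeff n k * Real.log N -
        (n.choose k : ℝ) ^ 2 * Real.log N) := by
    ring
  have hcancel : ∑ k ∈ Finset.range (n + 1), (logCoeff n k * Real.log (N.factorial : ℝ) +
      k * logCoeff n k * Real.log N - (n.choose k : ℝ) ^ 2 * Real.log N) = 0 := by
    rw [Finset.sum_sub_distrib, Finset.sum_add_distrib, ← Finset.sum_mul, ← Finset.sum_mul,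
      ← Finset.sum_mul, sum_logCoeff, sum_mul_logCoeff hn, sum_sq_choose]
    ring
  rw [Finset.sum_congr rfl fun k _ => hexpand k, Finset.sum_add_distrib, hcancel, add_zero]

theorem hasSum_neg_sqBetaPrimitive {n : ℕ} (hn : n ≠ 0) :
    HasSum (fun ν : ℕ => -sqBetaPrimitive n ((n : ℝ) + 1 + ν))
      (n.centralBinom * Real.eulerMascheroniConstant - sondowA n + sondowL n) := by
  rw [hasSum_iff_tendsto_nat_of_nonneg
    fun ν => neg_nonneg.2 (sqBetaPrimitive_neg n (by positivity)).le]
  simp only [sum_neg_sqBetaPrimitive]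
  exact (((tendsto_sum_harmonic_sub_log_factorial hn).comp
    (tendsto_add_atTop_nat n)).sub_const _).add_const _

theorem hasSum_neg_sqBetaPrimitive_sondowI {n : ℕ} (hn : n ≠ 0) :
    HasSum (fun ν : ℕ => -sqBetaPrimitive n ((n : ℝ) + 1 + ν)) (sondowI n) := by
  have ha : (0 : ℝ) < (n : ℝ) + 1 := by positivity
  have hint (ν : ℕ) : ∫ t in Set.Ioi ((n : ℝ) + 1), beta (n + 1) (t + ν) ^ 2 =
      -sqBetaPrimitive n ((n : ℝ) + 1 + ν) := integral_sq_beta_add n ha ν.cast_nonneg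
  have hI : sondowI n = ∫ t in Set.Ioi ((n : ℝ) + 1), ∑' ν : ℕ, beta (n + 1) (t + ν) ^ 2 :=
    setIntegral_congr_fun measurableSet_Ioi fun t ht => sondowIntegrand_eq_tsum n (ha.trans ht)
  have hnorm : Summable fun ν : ℕ =>
      ∫ t in Set.Ioi ((n : ℝ) + 1), ‖beta (n + 1) (t + ν) ^ 2‖ := by
    simp only [norm_pow, Real.norm_eq_abs, sq_abs, hint]
    exact (hasSum_neg_sqBetaPrimitive hn).summable
  have h := hasSum_integral_of_summable_integral_norm
    (fun ν : ℕ => integrableOn_sq_beta_add n ha ν.cast_nonneg) hnorm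
  simpa only [hint, ← hI] using h

theorem sondowI_eq {n : ℕ} (hn : n ≠ 0) :
    sondowI n = n.centralBinom * Real.eulerMascheroniConstant - sondowA n + sondowL n :=
  (hasSum_neg_sqBetaPrimitive_sondowI hn).unique (hasSum_neg_sqBetaPrimitive hn)

theorem sondowI_pos {n : ℕ} (hn : n ≠ 0) : 0 < sondowI n := by
  have h := hasSum_neg_sqBetaPrimitive_sondowI hn
  have hpos (ν : ℕ) : 0 < -sqBetaPrimitive n ((n : ℝ) + 1 + ν) :=
    neg_pos.2 (sqBetaPrimitive_neg n (by positivity))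
  rw [← h.tsum_eq]
  exact h.summable.tsum_pos (fun ν => (hpos ν).le) 0 (hpos 0)

theorem integrableOn_sondowIntegrand {n : ℕ} (hn : n ≠ 0) :
    IntegrableOn (sondowIntegrand n) (Set.Ioi ((n : ℝ) + 1)) :=
  Integrable.of_integral_ne_zero (sondowI_pos hn).ne'

theorem sondowI_succ_le {n : ℕ} (hn : n ≠ 0) : sondowI (n + 1) ≤ sondowI n / 16 := by
  refine hasSum_le (fun ν => ?_) (hasSum_neg_sqBetaPrimitive_sondowI n.succ_ne_zero)
    ((hasSum_neg_sqBetaPrimitive_sondowI hn).div_const 16)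
  rw [Nat.cast_succ, add_right_comm]
  exact neg_sqBetaPrimitive_succ_le n (by positivity)

theorem sondowI_succ_le_div_pow (n : ℕ) : sondowI (n + 1) ≤ sondowI 1 / 16 ^ n := by
  induction n with
  | zero => simp
  | succ n ih =>
    refine (sondowI_succ_le n.succ_ne_zero).trans ?_
    rw [pow_succ, ← div_div]
    gcongr

/-! ### The logarithm of `S_n` and the fractional part -/

theorem harmonic_add_sum_Icc {k N : ℕ} (h : k ≤ N) :
    (harmonic k : ℝ) + ∑ j ∈ Finset.Icc (k + 1) N, (1 : ℝ) / j = harmonic N := by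
  induction N, h using Nat.le_induction with
  | base => simp
  | succ N hN ih =>
    rw [Finset.sum_Icc_succ_top (by omega), ← add_assoc, ih, harmonic_succ]
    push_cast
    ring

theorem sum_choose_sq_mul_two_mul_lcmUpTo_div {n k : ℕ} (hk : k ≤ n - k) :
    ∑ j ∈ Finset.Icc (k + 1) (n - k),
      ((n.choose k ^ 2 * (2 * lcmUpTo (2 * n) / j) : ℕ) : ℝ) =
      -(lcmUpTo (2 * n) * logCoeff n k) := by
  have hterm : ∀ j ∈ Finset.Icc (k + 1) (n - k),
      ((n.choose k ^ 2 * (2 * lcmUpTo (2 * n) / j) : ℕ) : ℝ) =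
        2 * (n.choose k : ℝ) ^ 2 * lcmUpTo (2 * n) * (1 / j) := by
    intro j hj
    obtain ⟨hkj, hjn⟩ := Finset.mem_Icc.1 hj
    have hdvd : j ∣ 2 * lcmUpTo (2 * n) := (dvd_lcmUpTo (by omega) (by omega)).mul_left 2
    rw [Nat.cast_mul, Nat.cast_div hdvd (Nat.cast_ne_zero.2 (by omega))]
    push_cast
    ring
  rw [Finset.sum_congr rfl hterm, ← Finset.mul_sum, logCoeff, ← harmonic_add_sum_Icc hk]
  ring

theorem sum_Icc_min_logCoeff {n m : ℕ} (hm : 1 ≤ m) (hmn : m ≤ n) :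
    ∑ k ∈ Finset.Icc 0 (min (m - 1) (n - m)), logCoeff n k =
      ∑ k ∈ Finset.range m, logCoeff n k := by
  rw [← Nat.range_succ_eq_Icc_zero]
  rcases le_total (m - 1) (n - m) with h | h
  · rw [min_eq_left h, Nat.sub_add_cancel hm]
  · have hIco := sum_Ico_logCoeff n (n - m + 1)
    rw [show n + 1 - (n - m + 1) = m by omega] at hIco
    rw [min_eq_right h, ← Finset.sum_range_add_sum_Ico _ (show n - m + 1 ≤ m by omega), hIco,
      add_zero]

theorem log_factorial_add (n k : ℕ) :
    Real.log ((n + k).factorial : ℝ) =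
      Real.log (n.factorial : ℝ) + ∑ m ∈ Finset.Icc 1 k, Real.log ((n + m : ℕ) : ℝ) := by
  induction k with
  | zero => simp
  | succ k ih =>
    rw [Finset.sum_Icc_succ_top (by omega), ← add_assoc, ← add_assoc, ← ih, log_factorial_succ,
      Nat.cast_succ, add_comm]

theorem sondowL_eq_sum_log (n : ℕ) :
    sondowL n = ∑ m ∈ Finset.Icc 1 n,
      -(∑ k ∈ Finset.range m, logCoeff n k) * Real.log ((n + m : ℕ) : ℝ) := by
  simp only [sondowL, log_factorial_add, mul_add, Finset.sum_add_distrib, Finset.mul_sum]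
  rw [← Finset.sum_mul, sum_logCoeff, zero_mul, zero_add, Finset.sum_comm'
    (t' := Finset.Icc 1 n) (s' := fun m => Finset.Ico m (n + 1)) fun k m => by
      simp only [Finset.mem_range, Finset.mem_Icc, Finset.mem_Ico]; omega]
  refine Finset.sum_congr rfl fun m hm => ?_
  have hsplit := Finset.sum_range_add_sum_Ico (logCoeff n)
    (Nat.le_succ_of_le (Finset.mem_Icc.1 hm).2)
  rw [Nat.succ_eq_add_one, sum_logCoeff] at hsplit
  rw [← Finset.sum_mul, eq_neg_of_add_eq_zero_right hsplit]

theorem log_sondowS (n : ℕ) :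
    Real.log (sondowS n : ℝ) = lcmUpTo (2 * n) * sondowL n := by
  have hpos : ∀ m ∈ Finset.Icc 1 n, 0 < n + m := fun m hm => by
    have := (Finset.mem_Icc.1 hm).1
    omega
  simp only [sondowS, Nat.cast_prod, Nat.cast_pow]
  rw [Real.log_prod fun m hm => by have := hpos m hm; positivity, sondowL_eq_sum_log,
    Finset.mul_sum]
  refine Finset.sum_congr rfl fun m hm => ?_
  have := hpos m hm
  obtain ⟨hm1, hmn⟩ := Finset.mem_Icc.1 hm
  rw [Real.log_prod fun k _ => by positivity, ← sum_Icc_min_logCoeff hm1 hmn, ← mul_assoc, mul_neg,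
    Finset.mul_sum, ← Finset.sum_neg_distrib, Finset.sum_mul]
  refine Finset.sum_congr rfl fun k hk => ?_
  have hkn := (Finset.mem_Icc.1 hk).2
  rw [Real.log_prod fun j _ => by positivity, ← sum_choose_sq_mul_two_mul_lcmUpTo_div (by omega),
    Finset.sum_mul]
  exact Finset.sum_congr rfl fun j _ => Real.log_pow _ _

theorem exists_int_lcmUpTo_mul_harmonic {N j : ℕ} (h : j ≤ N) :
    ∃ z : ℤ, (lcmUpTo N : ℝ) * (harmonic j : ℝ) = z := by
  induction j with
  | zero => exact ⟨0, by simp⟩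
  | succ j ih =>
    obtain ⟨z, hz⟩ := ih (Nat.le_of_succ_le h)
    obtain ⟨c, hc⟩ := dvd_lcmUpTo j.succ_pos h
    refine ⟨z + c, ?_⟩
    have hj : (j : ℝ) + 1 ≠ 0 := by positivity
    rw [harmonic_succ]
    push_cast
    rw [mul_add, hz, hc]
    push_cast
    field_simp

theorem exists_int_lcmUpTo_mul_sondowA (n : ℕ) :
    ∃ z : ℤ, (lcmUpTo (2 * n) : ℝ) * sondowA n = z := by
  have hterm : ∀ k ∈ Finset.range (n + 1), ∃ z : ℤ,
      (lcmUpTo (2 * n) : ℝ) * ((n.choose k : ℝ) ^ 2 * (harmonic (n + k) : ℝ)) = z := by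
    intro k hk
    obtain ⟨z, hz⟩ := exists_int_lcmUpTo_mul_harmonic
      (show n + k ≤ 2 * n by have := Finset.mem_range.1 hk; omega)
    exact ⟨n.choose k ^ 2 * z, by push_cast; rw [mul_left_comm, hz]⟩
  choose! z hz using hterm
  refine ⟨∑ k ∈ Finset.range (n + 1), z k, ?_⟩
  rw [sondowA, Finset.mul_sum, Finset.sum_congr rfl hz, Int.cast_sum]

theorem exists_int_lcmUpTo_mul_sondowI {n : ℕ} (hn : n ≠ 0) :
    ∃ z : ℤ, (lcmUpTo (2 * n) : ℝ) * sondowI n =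
      ((lcmUpTo (2 * n) * n.centralBinom : ℕ) : ℝ) * Real.eulerMascheroniConstant +
        Real.log (sondowS n : ℝ) - z := by
  obtain ⟨z, hz⟩ := exists_int_lcmUpTo_mul_sondowA n
  refine ⟨z, ?_⟩
  rw [log_sondowS, ← hz, sondowI_eq hn]
  push_cast
  ring

theorem lcmUpTo_pos (N : ℕ) : 0 < lcmUpTo N :=
  Nat.lcmUpto_pos N

theorem exists_rat_eq_eulerMascheroniConstant_of_fract {n : ℕ} (hn : n ≠ 0)
    (h : Int.fract (Real.log (sondowS n : ℝ)) = (lcmUpTo (2 * n) : ℝ) * sondowI n) :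
    ∃ q : ℚ, Real.eulerMascheroniConstant = (q : ℝ) := by
  obtain ⟨z, hz⟩ := exists_int_lcmUpTo_mul_sondowI hn
  have hne : ((lcmUpTo (2 * n) * n.centralBinom : ℕ) : ℝ) ≠ 0 :=
    Nat.cast_ne_zero.2 (Nat.mul_pos (lcmUpTo_pos _) n.centralBinom_pos).ne'
  refine ⟨(z - ⌊Real.log (sondowS n : ℝ)⌋ : ℚ) / (lcmUpTo (2 * n) * n.centralBinom : ℕ), ?_⟩
  rw [← h, Int.fract] at hz
  rw [Rat.cast_div, Rat.cast_natCast, eq_div_iff hne]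
  push_cast at hz ⊢
  linarith

theorem fract_log_sondowS_of_rational {q : ℚ} (hq : Real.eulerMascheroniConstant = (q : ℝ))
    {n : ℕ} (hn : n ≠ 0) (hden : q.den ≤ 2 * n)
    (hlt : (lcmUpTo (2 * n) : ℝ) * sondowI n < 1) :
    Int.fract (Real.log (sondowS n : ℝ)) = (lcmUpTo (2 * n) : ℝ) * sondowI n := by
  obtain ⟨z, hz⟩ := exists_int_lcmUpTo_mul_sondowI hn
  obtain ⟨c, hc⟩ := dvd_lcmUpTo q.pos hden
  have hden0 : (q.den : ℝ) ≠ 0 := Nat.cast_ne_zero.2 q.den_nz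
  have hint : ((lcmUpTo (2 * n) * n.centralBinom : ℕ) : ℝ) * (q : ℝ) =
      ((c * n.centralBinom * q.num : ℤ) : ℝ) := by
    rw [hc, Rat.cast_def]
    push_cast
    field_simp
  rw [hq, hint] at hz
  refine Int.fract_eq_iff.2 ⟨mul_nonneg (Nat.cast_nonneg _) (sondowI_pos hn).le, hlt,
    z - c * n.centralBinom * q.num, ?_⟩
  rw [hz]
  push_cast
  ring

/-! ### Chebyshev's bound for `d_N` -/

section Chebyshev

open ArithmeticFunction

theorem log_factorial_eq_sum_vonMangoldt {m N : ℕ} (h : m ≤ N) :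
    Real.log (m.factorial : ℝ) = ∑ d ∈ Finset.Ioc 0 N, vonMangoldt d * ((m / d : ℕ) : ℝ) := by
  have hlog : Real.log (m.factorial : ℝ) = ∑ d ∈ Finset.Ioc 0 m, Real.log d := by
    simpa [← Finset.Icc_add_one_left_eq_Ioc] using log_factorial_add 0 m
  simp only [hlog, ← log_apply, ← vonMangoldt_mul_zeta, sum_Ioc_mul_zeta_eq_sum]
  refine Finset.sum_subset (Finset.Ioc_subset_Ioc_right h) fun d hd hdm => ?_
  have hlt : m < d := by
    rw [Finset.mem_Ioc] at hd hdm
    omega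
  rw [Nat.div_eq_of_lt hlt, Nat.cast_zero, mul_zero]

theorem three_mul_div_add_le (n d : ℕ) :
    3 * n / d + 2 * (2 * n / d) + (if 2 * n < d ∧ d ≤ 6 * n then 1 else 0) ≤
      6 * n / d + n / d := by
  have hdiv {a b : ℕ} (hb : 0 < b) (hab : b * a = 6) : a * n / d = 6 * n / d / b := by
    rw [← hab, Nat.div_div_eq_div_mul, mul_comm d b, mul_assoc, Nat.mul_div_mul_left _ _ hb]
  have h3 := hdiv (a := 3) two_pos rfl
  have h2 := hdiv (a := 2) three_pos rfl
  have h1 := hdiv (a := 1) (b := 6) (by norm_num) rfl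
  rw [one_mul] at h1
  split_ifs with h
  · have hpos : 0 < 6 * n / d := Nat.div_pos h.2 (by omega)
    have hzero : 2 * n / d = 0 := Nat.div_eq_of_lt h.1
    omega
  · omega

-- `108 = 6 ^ 6 / (3 ^ 3 * 2 ^ 4)` is the growth rate of `(6n)! n! / ((3n)! (2n)!²)`.
theorem factorial_six_mul_mul_factorial_le (n : ℕ) :
    (6 * n).factorial * n.factorial ≤
      108 ^ n * ((3 * n).factorial * (2 * n).factorial ^ 2) := by
  induction n with
  | zero => simp
  | succ n ih =>
    have hratio : 6 * (6 * n + 1) * (6 * n + 5) ≤ 108 * ((2 * n + 1) * (n + 1)) := by nlinarith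
    simp only [mul_add_one, Nat.factorial_succ, pow_succ 108]
    calc _ = (3 * n + 3) * (3 * n + 2) * (3 * n + 1) * (4 * (2 * n + 1) * (n + 1)) *
          (6 * (6 * n + 1) * (6 * n + 5)) * ((6 * n).factorial * n.factorial) := by ring
      _ ≤ (3 * n + 3) * (3 * n + 2) * (3 * n + 1) * (4 * (2 * n + 1) * (n + 1)) *
          (108 * ((2 * n + 1) * (n + 1))) *
          (108 ^ n * ((3 * n).factorial * (2 * n).factorial ^ 2)) := by gcongr
      _ = _ := by ring

theorem log_factorial_six_mul_add_log_factorial_le (n : ℕ) :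
    Real.log ((6 * n).factorial : ℝ) + Real.log (n.factorial : ℝ) ≤
      n * Real.log 108 + (Real.log ((3 * n).factorial : ℝ) +
        2 * Real.log ((2 * n).factorial : ℝ)) := by
  have hle : ((6 * n).factorial : ℝ) * n.factorial ≤
      108 ^ n * ((3 * n).factorial * (2 * n).factorial ^ 2) := by
    exact_mod_cast factorial_six_mul_mul_factorial_le n
  have h := Real.log_le_log (by positivity) hle
  rwa [Real.log_mul (by positivity) (by positivity), Real.log_mul (by positivity) (by positivity),
    Real.log_mul (by positivity) (by positivity), Real.log_pow, Real.log_pow, Nat.cast_ofNat] at h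

theorem psi_six_mul_le (n : ℕ) :
    Chebyshev.psi (6 * n : ℕ) ≤ Chebyshev.psi (2 * n : ℕ) + n * Real.log 108 := by
  have hpsi : Chebyshev.psi (6 * n : ℕ) - Chebyshev.psi (2 * n : ℕ) =
      ∑ d ∈ Finset.Ioc 0 (6 * n),
        vonMangoldt d * ((if 2 * n < d ∧ d ≤ 6 * n then 1 else 0 : ℕ) : ℝ) := by
    simp only [Chebyshev.psi, Nat.floor_natCast, Nat.cast_ite, Nat.cast_one, Nat.cast_zero,
      mul_ite, mul_one, mul_zero]
    rw [← Finset.sum_filter, sub_eq_iff_eq_add', ← Finset.sum_Ioc_consecutive _ (Nat.zero_le _)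
      (Nat.mul_le_mul_right n (show 2 ≤ 6 by norm_num))]
    congr 2
    ext d
    simp only [Finset.mem_filter, Finset.mem_Ioc]
    omega
  have hsum := Finset.sum_le_sum fun d (_ : d ∈ Finset.Ioc 0 (6 * n)) =>
    mul_le_mul_of_nonneg_left (Nat.cast_le (α := ℝ).2 (three_mul_div_add_le n d))
      (vonMangoldt_nonneg (n := d))
  simp only [Nat.cast_add, Nat.cast_mul, Nat.cast_ofNat, mul_add, mul_left_comm _ (2 : ℝ),
    Finset.sum_add_distrib, ← Finset.mul_sum] at hsum
  rw [← hpsi, ← log_factorial_eq_sum_vonMangoldt (by omega),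
    ← log_factorial_eq_sum_vonMangoldt (by omega), ← log_factorial_eq_sum_vonMangoldt le_rfl,
    ← log_factorial_eq_sum_vonMangoldt (by omega)] at hsum
  linarith [log_factorial_six_mul_add_log_factorial_le n]

-- Any slope strictly between `log 128 / 4 = 7 / 4 * log 2` and `2 * log 2` would do.
theorem exists_psi_le : ∃ K : ℝ, ∀ N : ℕ, Chebyshev.psi N ≤ 15 / 8 * Real.log 2 * N + K := by
  refine ⟨Chebyshev.psi (110 : ℕ), fun N => ?_⟩
  have : 0 < Real.log 2 := Real.log_pos one_lt_two
  have hlog108 : Real.log 108 ≤ 7 * Real.log 2 := by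
    rw [← Real.log_rpow two_pos]
    exact Real.log_le_log (by norm_num) (by norm_num)
  induction N using Nat.strong_induction_on with
  | _ N ih =>
    rcases le_or_gt N 110 with hN | hN
    · exact (Chebyshev.psi_mono (Nat.cast_le.2 hN)).trans (le_add_of_nonneg_left (by positivity))
    · obtain ⟨n, hle, hge⟩ : ∃ n, N ≤ 6 * n ∧ 6 * n ≤ N + 5 := ⟨(N + 5) / 6, by omega, by omega⟩
      have hge' : (43 / 4 : ℝ) * n ≤ 15 / 8 * N := by
        have : (6 : ℝ) * n ≤ N + 5 := by exact_mod_cast hge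
        have : (111 : ℝ) ≤ N := by exact_mod_cast hN
        linarith
      calc Chebyshev.psi N ≤ Chebyshev.psi (6 * n : ℕ) := Chebyshev.psi_mono (Nat.cast_le.2 hle)
        _ ≤ Chebyshev.psi (2 * n : ℕ) + n * Real.log 108 := psi_six_mul_le n
        _ ≤ 15 / 8 * Real.log 2 * (2 * n : ℕ) + Chebyshev.psi (110 : ℕ) +
            n * (7 * Real.log 2) := by
          gcongr
          exact ih (2 * n) (by omega)
        _ = 43 / 4 * n * Real.log 2 + Chebyshev.psi (110 : ℕ) := by
          push_cast
          ring
        _ ≤ 15 / 8 * N * Real.log 2 + Chebyshev.psi (110 : ℕ) := by gcongr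
        _ = 15 / 8 * Real.log 2 * N + Chebyshev.psi (110 : ℕ) := by ring

end Chebyshev

theorem exists_lcmUpTo_le :
    ∃ C : ℝ, ∀ N : ℕ, (lcmUpTo N : ℝ) ≤ C * ((2 : ℝ) ^ (15 / 8 : ℝ)) ^ N := by
  obtain ⟨K, hK⟩ := exists_psi_le
  refine ⟨Real.exp K, fun N => ?_⟩
  have hpsi : Real.log (lcmUpTo N) = Chebyshev.psi N := (Chebyshev.psi_eq_log_lcmUpto N).symm
  rw [← Real.exp_log (Nat.cast_pos.2 (lcmUpTo_pos N)), hpsi, Real.rpow_def_of_pos two_pos,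
    ← Real.exp_nat_mul, ← Real.exp_add, Real.exp_le_exp]
  linarith [hK N]

theorem tendsto_lcmUpTo_mul_sondowI :
    Tendsto (fun n : ℕ => (lcmUpTo (2 * n) : ℝ) * sondowI n) atTop (𝓝 0) := by
  obtain ⟨C, hC⟩ := exists_lcmUpTo_le
  set r : ℝ := 2 ^ (15 / 8 : ℝ) with hr
  have : 0 < r := by positivity
  have hlt : r ^ 2 / 16 < 1 := by
    rw [div_lt_one (by norm_num), hr, ← Real.rpow_natCast, ← Real.rpow_mul two_pos.le]
    calc (2 : ℝ) ^ (15 / 8 * (2 : ℕ) : ℝ) < 2 ^ (4 : ℝ) :=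
          Real.rpow_lt_rpow_of_exponent_lt one_lt_two (by norm_num)
      _ = 16 := by norm_num
  have hlim := (tendsto_pow_atTop_nhds_zero_of_lt_one (by positivity) hlt).const_mul
    (C * r ^ 2 * sondowI 1)
  rw [mul_zero] at hlim
  refine (tendsto_add_atTop_iff_nat 1).1 (squeeze_zero (fun n => ?_) (fun n => ?_) hlim)
  · exact mul_nonneg (Nat.cast_nonneg _) (sondowI_pos n.succ_ne_zero).le
  · calc (lcmUpTo (2 * (n + 1)) : ℝ) * sondowI (n + 1)
        ≤ C * r ^ (2 * (n + 1)) * (sondowI 1 / 16 ^ n) :=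
          mul_le_mul (hC _) (sondowI_succ_le_div_pow n) (sondowI_pos n.succ_ne_zero).le
            ((Nat.cast_nonneg _).trans (hC _))
      _ = C * r ^ 2 * sondowI 1 * (r ^ 2 / 16) ^ n := by
          rw [mul_add_one, pow_add, pow_mul, div_pow]
          ring

theorem theorem1 :
    (∀ n : ℕ, 0 < n →
      (∀ t : ℝ, (n : ℝ) + 1 ≤ t →
        Summable (hyp3F2Term (n + 1) (n + 1) (2 * n + 1) (2 * n + 2) (2 * n + 1 + t) 1)) ∧
      MeasureTheory.IntegrableOn (sondowIntegrand n) (Set.Ioi ((n : ℝ) + 1))) ∧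
    List.TFAE [
      ∃ n : ℕ, 0 < n ∧
        Int.fract (Real.log (sondowS n : ℝ)) = (lcmUpTo (2 * n) : ℝ) * sondowI n,
      ∃ N : ℕ, ∀ n : ℕ, N ≤ n →
        Int.fract (Real.log (sondowS n : ℝ)) = (lcmUpTo (2 * n) : ℝ) * sondowI n,
      ∃ q : ℚ, Real.eulerMascheroniConstant = (q : ℝ)] := by
  refine ⟨fun n hn => ⟨fun t ht => summable_hyp3F2Term n (n.cast_add_one_pos.trans_le ht),
    integrableOn_sondowIntegrand hn.ne'⟩, ?_⟩
  tfae_have 1 → 3 := fun ⟨n, hn, h⟩ => exists_rat_eq_eulerMascheroniConstant_of_fract hn.ne' h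
  tfae_have 2 → 1 := fun ⟨N, h⟩ => ⟨N + 1, N.succ_pos, h (N + 1) N.le_succ⟩
  tfae_have 3 → 2 := fun ⟨q, hq⟩ => by
    obtain ⟨N, hN⟩ := eventually_atTop.1
      (tendsto_lcmUpTo_mul_sondowI.eventually_lt_const zero_lt_one)
    refine ⟨max N q.den, fun n hn => ?_⟩
    obtain ⟨hNn, hqn⟩ := max_le_iff.1 hn
    exact fract_log_sondowS_of_rational hq (q.pos.trans_le hqn).ne' (by omega) (hN n hNn)
  tfae_finish
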